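/- Let $N\in\mathbb{N}$ and $p\in(1,\infty)$. For a non-empty open set $\Omega\subset\mathbb{R}^N$ let $W^{1,p}(\Omega)$ be the Sobolev space of all $u\in L^p(\Omega)$ whose distributional first order partial derivatives belong to $L^p(\Omega)$, with norm given by \[ \|u\|_{W^{1,p}(\Omega)}^p=\|u\|_{L^p(\Omega)}^p+\sum_{i=1}^N\|\partial_i u\|_{L^p(\Omega)}^p, \] and let $\tilde W^{1,p}(\Omega)$ be the closure in $W^{1,p}(\Omega)$ of $\{u|_\Omega : u\in C_c(\overline\Omega),\ u|_\Omega\in W^{1,p}(\Omega)\}$, where $C_c(\overline\Omega)$ is the space of real-valued continuous functions with compact support on $\overline\Omega$. For $A\subset\overline\Omega$ the relative $p$-capacity of $A$ is \[ \mathrm{Cap}_{p,\Omega}(A)=\inf\{\|u\|_{W^{1,p}(\Omega)}^p : u\in\tilde W^{1,p}(\Omega),\ u\ge 1 \text{ a.e. on } O\cap\Omega \text{ for some } O\supset A \text{ open in } \overline\Omega\}\in[0,\infty]. \] Let $U\subset V\subset\mathbb{R}^N$ be non-empty open sets. Then for every $A\subset U$, \[ \mathrm{Cap}_{p,U}(A)=0\iff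 \mathrm{Cap}_{p,V}(A)=0. \] Consequently, whether a set is polar does not depend on the ambient open set containing it: if $U,V\subset\mathbb{R}^N$ are arbitrary non-empty open sets and $A\subset U\cap V$, then $\mathrm{Cap}_{p,U}(A)=0$ if and only if $\mathrm{Cap}_{p,V}(A)=0$. -/

import Mathlib

open MeasureTheory
open scoped ENNReal ContDiff

noncomputable section

namespace RelCap

/-- `g` is the weak partial derivative `∂ᵢ u` (derivative in the sense of distributions) on `Ω`.
Only the values of `u` and `g` on `Ω` matter. -/
def IsWeakPartial {N : ℕ} (Ω : Set (EuclideanSpace ℝ (Fin N))) (i : Fin N)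
    (u g : EuclideanSpace ℝ (Fin N) → ℝ) : Prop :=
  LocallyIntegrableOn u Ω ∧ LocallyIntegrableOn g Ω ∧
    ∀ φ : EuclideanSpace ℝ (Fin N) → ℝ, ContDiff ℝ ∞ φ → HasCompactSupport φ → tsupport φ ⊆ Ω →
      ∫ x in Ω, u x * fderiv ℝ φ x (EuclideanSpace.single i 1) = -∫ x in Ω, g x * φ x

/-- `u` represents an element of the Sobolev space `W^{1,p}(Ω)`. -/
def MemW {N : ℕ} (p : ℝ) (Ω : Set (EuclideanSpace ℝ (Fin N)))
    (u : EuclideanSpace ℝ (Fin N) → ℝ) : Prop :=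
  MemLp u (ENNReal.ofReal p) (volume.restrict Ω) ∧
    ∀ i, ∃ g, IsWeakPartial Ω i u g ∧ MemLp g (ENNReal.ofReal p) (volume.restrict Ω)

open Classical in
/-- The weak partial derivative `∂ᵢ u` on `Ω`, where it exists (for open `Ω` it is unique up to
equality almost everywhere on `Ω`); zero otherwise. -/
def weakPartial {N : ℕ} (Ω : Set (EuclideanSpace ℝ (Fin N))) (i : Fin N)
    (u : EuclideanSpace ℝ (Fin N) → ℝ) : EuclideanSpace ℝ (Fin N) → ℝ :=
  if h : ∃ g, IsWeakPartial Ω i u g then h.choose else 0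

/-- The `p`-th power of the norm of `W^{1,p}(Ω)`, for `u` in that space:
`‖u‖_{L^p(Ω)}^p + ∑ᵢ ‖∂ᵢ u‖_{L^p(Ω)}^p`. -/
def normPow {N : ℕ} (p : ℝ) (Ω : Set (EuclideanSpace ℝ (Fin N)))
    (u : EuclideanSpace ℝ (Fin N) → ℝ) : ℝ≥0∞ :=
  eLpNorm u (ENNReal.ofReal p) (volume.restrict Ω) ^ p +
    ∑ i, eLpNorm (weakPartial Ω i u) (ENNReal.ofReal p) (volume.restrict Ω) ^ p

/-- The restriction of `w` to the closure of `Ω` belongs to `C_c(closure Ω)`. -/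
def MemCc {N : ℕ} (Ω : Set (EuclideanSpace ℝ (Fin N)))
    (w : EuclideanSpace ℝ (Fin N) → ℝ) : Prop :=
  ContinuousOn w (closure Ω) ∧
    ∃ K, IsCompact K ∧ K ⊆ closure Ω ∧ ∀ x ∈ closure Ω \ K, w x = 0

/-- `u` represents an element of the closure of `W^{1,p}(Ω) ∩ C_c(closure Ω)` in `W^{1,p}(Ω)`. -/
def MemWTilde {N : ℕ} (p : ℝ) (Ω : Set (EuclideanSpace ℝ (Fin N)))
    (u : EuclideanSpace ℝ (Fin N) → ℝ) : Prop :=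
  MemW p Ω u ∧ ∀ ε : ℝ≥0∞, 0 < ε →
    ∃ w, MemCc Ω w ∧ MemW p Ω w ∧ normPow p Ω (fun x => u x - w x) < ε

/-- `u` is admissible for `A ⊆ closure Ω`: `u ∈ W̃^{1,p}(Ω)` and `u ≥ 1` almost everywhere on
`O ∩ Ω`, for some relatively open `O = G ∩ closure Ω` containing `A`. -/
def Admissible {N : ℕ} (p : ℝ) (Ω A : Set (EuclideanSpace ℝ (Fin N)))
    (u : EuclideanSpace ℝ (Fin N) → ℝ) : Prop :=
  MemWTilde p Ω u ∧
    ∃ G, IsOpen G ∧ A ⊆ G ∩ closure Ω ∧ ∀ᵐ x ∂volume.restrict (G ∩ Ω), 1 ≤ u x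

/-- The relative `p`-capacity of `A ⊆ closure Ω` with respect to `Ω` (`∞` if there is no
admissible function). -/
def relCap {N : ℕ} (p : ℝ) (Ω A : Set (EuclideanSpace ℝ (Fin N))) : ℝ≥0∞ :=
  ⨅ (u : EuclideanSpace ℝ (Fin N) → ℝ) (_ : Admissible p Ω A u), normPow p Ω u

end RelCap

end

/-! Every open set is compared with the whole space. Restricting admissible functions to a smaller
open set does not increase norms, so capacity zero passes down (`relCap_mono`).

For the converse, let `A ⊆ Ω` have capacity zero in `Ω`. Cover `Ω` by countably many open sets `W
n`, each with a cutoff `η n` supported compactly in `Ω` and equal to 1 on `W n`. The product of `η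
n` with an admissible function is Sobolev on the whole space. The product rule costs a constant
depending on `n`, but capacity zero lets the admissible function be chosen afresh for each `n`, so
the product can have norm as small as desired. Composing with `2t²/(1+t²)` makes it nonnegative,
keeps it small, and keeps it at least 1 where the product was. With summable norms, the sum over `n`
converges, dominates every term and is admissible for `A` (`exists_isSmoothLimit_ge`).

Membership in `W̃` on the whole space comes from `IsSmoothLimit`: compactly supported Sobolev
functions belong to this class by mollification, and the class is stable under smooth composition,
sums and limits. -/

noncomputable section

namespace RelCap

/-! ### Weak derivatives and monotonicity of the capacity -/

section

variable {N : ℕ} {p : ℝ} {i : Fin N} {Ω Ω' A : Set (EuclideanSpace ℝ (Fin N))}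
  {u v g h φ : EuclideanSpace ℝ (Fin N) → ℝ}

/-- Integrals against a function supported in `Ω` do not see the complement of `Ω`. -/
lemma setIntegral_mul_eq_integral (f : EuclideanSpace ℝ (Fin N) → ℝ) (hφ : tsupport φ ⊆ Ω) :
    ∫ x in Ω, f x * φ x = ∫ x, f x * φ x :=
  setIntegral_eq_integral_of_forall_compl_eq_zero fun x hx => by
    rw [image_eq_zero_of_notMem_tsupport fun h => hx (hφ h), mul_zero]

lemma tsupport_fderiv_apply_subset (φ : EuclideanSpace ℝ (Fin N) → ℝ)
    (v : EuclideanSpace ℝ (Fin N)) : tsupport (fun x => fderiv ℝ φ x v) ⊆ tsupport φ :=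
  closure_minimal (fun x hx => by
    by_contra hx'
    refine hx ?_
    change fderiv ℝ φ x v = 0
    rw [image_eq_zero_of_notMem_tsupport fun h => hx' (tsupport_fderiv_subset ℝ h)]
    rfl) (isClosed_tsupport φ)

lemma continuous_fderiv_apply (hφ : ContDiff ℝ ∞ φ) (v : EuclideanSpace ℝ (Fin N)) :
    Continuous fun x => fderiv ℝ φ x v :=
  (hφ.continuous_fderiv (by simp)).clm_apply continuous_const

lemma hasCompactSupport_fderiv_apply (hφ : HasCompactSupport φ)
    (v : EuclideanSpace ℝ (Fin N)) : HasCompactSupport fun x => fderiv ℝ φ x v :=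
  hφ.of_isClosed_subset (isClosed_tsupport _) (tsupport_fderiv_apply_subset φ v)

/-- A locally integrable function on an open set times a continuous function with compact support
in that set is integrable. -/
lemma integrable_mul_of_tsupport_subset (hu : LocallyIntegrableOn u Ω)
    (hφ : Continuous φ) (hc : HasCompactSupport φ) (hs : tsupport φ ⊆ Ω) :
    Integrable fun x => u x * φ x := by
  have h1 : IntegrableOn u (tsupport φ) := hu.integrableOn_compact_subset hs hc
  have h2 : IntegrableOn (fun x => u x * φ x) (tsupport φ) :=
    h1.mul_continuousOn hφ.continuousOn hc
  refine (integrableOn_iff_integrable_of_support_subset fun x hx => ?_).1 h2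
  by_contra hx'
  exact hx (by simp [image_eq_zero_of_notMem_tsupport hx'])

/-- The weak partial derivative tested with integrals over the whole space. -/
lemma IsWeakPartial.integral_eq (hu : IsWeakPartial Ω i u g) (hφ : ContDiff ℝ ∞ φ)
    (hc : HasCompactSupport φ) (hs : tsupport φ ⊆ Ω) :
    ∫ x, u x * fderiv ℝ φ x (EuclideanSpace.single i 1) = -∫ x, g x * φ x := by
  rw [← setIntegral_mul_eq_integral g hs, ← hu.2.2 φ hφ hc hs,
    setIntegral_mul_eq_integral u ((tsupport_fderiv_apply_subset φ _).trans hs)]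

lemma IsWeakPartial.of_integral_eq (hu : LocallyIntegrableOn u Ω) (hg : LocallyIntegrableOn g Ω)
    (H : ∀ φ : EuclideanSpace ℝ (Fin N) → ℝ, ContDiff ℝ ∞ φ → HasCompactSupport φ →
      tsupport φ ⊆ Ω →
      ∫ x, u x * fderiv ℝ φ x (EuclideanSpace.single i 1) = -∫ x, g x * φ x) :
    IsWeakPartial Ω i u g :=
  ⟨hu, hg, fun φ hφ hc hs => by
    rw [setIntegral_mul_eq_integral g hs, ← H φ hφ hc hs,
      setIntegral_mul_eq_integral u ((tsupport_fderiv_apply_subset φ _).trans hs)]⟩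

/-- Test functions on the smaller set are test functions on the larger one, and integrals over the
whole space do not see the domain. -/
lemma IsWeakPartial.mono (hu : IsWeakPartial Ω' i u g) (h : Ω ⊆ Ω') : IsWeakPartial Ω i u g :=
  .of_integral_eq (hu.1.mono_set h) (hu.2.1.mono_set h) fun _ hφ hc hs =>
    hu.integral_eq hφ hc (hs.trans h)

lemma IsWeakPartial.sub (hu : IsWeakPartial Ω i u g) (hv : IsWeakPartial Ω i v h) :
    IsWeakPartial Ω i (fun x => u x - v x) (fun x => g x - h x) := by
  refine .of_integral_eq (hu.1.sub hv.1) (hu.2.1.sub hv.2.1) fun φ hφ hc hs => ?_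
  have hs' := (tsupport_fderiv_apply_subset φ (EuclideanSpace.single i 1)).trans hs
  have hc' := hasCompactSupport_fderiv_apply hc (EuclideanSpace.single i 1)
  have hφ' := continuous_fderiv_apply hφ (EuclideanSpace.single i 1)
  simp only [sub_mul]
  rw [integral_sub (integrable_mul_of_tsupport_subset hu.1 hφ' hc' hs')
      (integrable_mul_of_tsupport_subset hv.1 hφ' hc' hs'),
    integral_sub (integrable_mul_of_tsupport_subset hu.2.1 hφ.continuous hc hs)
      (integrable_mul_of_tsupport_subset hv.2.1 hφ.continuous hc hs),
    hu.integral_eq hφ hc hs, hv.integral_eq hφ hc hs]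
  ring

/-- Weak partial derivatives on an open set are unique up to equality almost everywhere. -/
lemma IsWeakPartial.ae_eq (hΩ : IsOpen Ω) (hg : IsWeakPartial Ω i u g)
    (hh : IsWeakPartial Ω i u h) : g =ᵐ[volume.restrict Ω] h := by
  have := hΩ.ae_eq_zero_of_integral_contDiff_smul_eq_zero (hg.2.1.sub hh.2.1)
    fun φ hφ hc hs => by
      have := hg.sub hh |>.integral_eq hφ hc hs
      simp only [sub_self, zero_mul, integral_zero, zero_eq_neg] at this
      simpa [mul_comm] using this
  refine (ae_restrict_iff' hΩ.measurableSet).2 ?_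
  filter_upwards [this] with x hx hxΩ
  exact sub_eq_zero.1 (hx hxΩ)

lemma weakPartial_ae_eq (hΩ : IsOpen Ω) (hg : IsWeakPartial Ω i u g) :
    weakPartial Ω i u =ᵐ[volume.restrict Ω] g := by
  have hex : ∃ g, IsWeakPartial Ω i u g := ⟨g, hg⟩
  rw [weakPartial, dif_pos hex]
  exact hex.choose_spec.ae_eq hΩ hg

/-- Uniqueness of weak derivatives on open sets makes the choice inside `weakPartial` irrelevant. -/
lemma normPow_eq (hΩ : IsOpen Ω) {g : Fin N → EuclideanSpace ℝ (Fin N) → ℝ}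
    (hg : ∀ i, IsWeakPartial Ω i u (g i)) :
    normPow p Ω u = eLpNorm u (ENNReal.ofReal p) (volume.restrict Ω) ^ p +
      ∑ i, eLpNorm (g i) (ENNReal.ofReal p) (volume.restrict Ω) ^ p := by
  simp only [normPow, fun i => eLpNorm_congr_ae (p := ENNReal.ofReal p)
    (weakPartial_ae_eq hΩ (hg i))]

lemma MemW.mono (hu : MemW p Ω' u) (h : Ω ⊆ Ω') : MemW p Ω u :=
  ⟨hu.1.mono_measure (Measure.restrict_mono_set _ h), fun i =>
    let ⟨g, hg, hg'⟩ := hu.2 i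
    ⟨g, hg.mono h, hg'.mono_measure (Measure.restrict_mono_set _ h)⟩⟩

lemma MemW.sub (hu : MemW p Ω u) (hv : MemW p Ω v) : MemW p Ω (fun x => u x - v x) :=
  ⟨hu.1.sub hv.1, fun i =>
    let ⟨_, hg, hg'⟩ := hu.2 i
    let ⟨_, hh, hh'⟩ := hv.2 i
    ⟨_, hg.sub hh, hg'.sub hh'⟩⟩

lemma normPow_mono (hp : 0 ≤ p) (hΩ : IsOpen Ω) (hΩ' : IsOpen Ω') (h : Ω ⊆ Ω')
    (hu : MemW p Ω' u) : normPow p Ω u ≤ normPow p Ω' u := by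
  choose g hg _ using hu.2
  rw [normPow_eq hΩ fun i => (hg i).mono h, normPow_eq hΩ' hg]
  have hle := Measure.restrict_mono_set volume h
  gcongr

/-- Restricting functions to a smaller open set does not increase the relative capacity. -/
lemma relCap_mono (hp : 0 ≤ p) (hΩ : IsOpen Ω) (hΩ' : IsOpen Ω') (h : Ω ⊆ Ω') (hA : A ⊆ Ω) :
    relCap p Ω A ≤ relCap p Ω' A := by
  refine le_iInf₂ fun u ⟨⟨hW, happ⟩, G, hG, hAG, hu⟩ => ?_
  refine (iInf₂_le u ⟨⟨hW.mono h, fun ε hε => ?_⟩, G, hG, fun x hx =>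
    ⟨(hAG hx).1, subset_closure (hA hx)⟩, ?_⟩).trans (normPow_mono hp hΩ hΩ' h hW)
  · obtain ⟨w, ⟨hwc, K, hK, hKs, hw0⟩, hwW, hlt⟩ := happ ε hε
    refine ⟨w, ⟨hwc.mono (closure_mono h), K ∩ closure Ω, hK.inter_right isClosed_closure,
      Set.inter_subset_right, fun x hx => hw0 x ⟨closure_mono h hx.1, fun hxK =>
        hx.2 ⟨hxK, hx.1⟩⟩⟩, hwW.mono h, (normPow_mono hp hΩ hΩ' h (hW.sub hwW)).trans_lt hlt⟩
  · exact ae_restrict_of_ae_restrict_of_subset (Set.inter_subset_inter_right _ h) hu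

end

/-! ### Limits in `L^q` of smooth compactly supported functions -/

section

open Filter Topology

/-- Dominated convergence to zero for products in `L^q`. -/
lemma tendsto_eLpNorm_mul_of_dominated {α : Type*} {_ : MeasurableSpace α} {μ : Measure α}
    {q : ℝ≥0∞} (hq : q ≠ 0) (hq' : q ≠ ⊤) {f : ℕ → α → ℝ} {g : α → ℝ} {C : ℝ}
    (hf : ∀ n, AEStronglyMeasurable (f n) μ) (hg : MemLp g q μ) (hC : ∀ n x, ‖f n x‖ ≤ C)
    (hlim : ∀ᵐ x ∂μ, Tendsto (fun n => f n x) atTop (𝓝 0)) :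
    Tendsto (fun n => eLpNorm (fun x => f n x * g x) q μ) atTop (𝓝 0) := by
  have hq0 : 0 < q.toReal := ENNReal.toReal_pos hq hq'
  simp only [eLpNorm_eq_lintegral_rpow_enorm_toReal hq hq']
  have key : Tendsto (fun n => ∫⁻ x, ‖f n x * g x‖ₑ ^ q.toReal ∂μ) atTop (𝓝 (∫⁻ _, 0 ∂μ)) := by
    refine tendsto_lintegral_of_dominated_convergence' (fun x => ‖C * g x‖ₑ ^ q.toReal)
      (fun n => ((hf n).mul hg.1).enorm.pow_const _) (fun n => ae_of_all _ fun x => ?_) ?_ ?_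
    · refine ENNReal.rpow_le_rpow (enorm_le_iff_norm_le.2 ?_) hq0.le
      rw [norm_mul, norm_mul]
      exact mul_le_mul_of_nonneg_right ((hC n x).trans (le_abs_self C)) (norm_nonneg _)
    · exact (lintegral_rpow_enorm_lt_top_of_eLpNorm_lt_top hq hq' (hg.const_mul C).2).ne
    · filter_upwards [hlim] with x hx
      have h1 : Tendsto (fun n => ‖f n x * g x‖ₑ) atTop (𝓝 0) := by
        simpa using (hx.mul_const (g x)).enorm
      have h2 := (ENNReal.continuous_rpow_const (y := q.toReal)).tendsto 0 |>.comp h1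
      simpa [Function.comp_def, ENNReal.zero_rpow_of_pos hq0] using h2
  rw [lintegral_zero] at key
  have h2 := (ENNReal.continuous_rpow_const (y := 1 / q.toReal)).tendsto 0 |>.comp key
  rwa [ENNReal.zero_rpow_of_pos (by positivity)] at h2

/-- Convergence in `L^q` implies convergence of integrals against a function in the dual space. -/
lemma tendsto_integral_mul_of_tendsto_eLpNorm {α : Type*} {_ : MeasurableSpace α} {μ : Measure α}
    {q r : ℝ≥0∞} [ENNReal.HolderTriple q r 1] {f : ℕ → α → ℝ} {g ψ : α → ℝ}
    (hf : ∀ n, MemLp (f n) q μ) (hg : MemLp g q μ) (hψ : MemLp ψ r μ)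
    (hlim : Tendsto (fun n => eLpNorm (fun x => g x - f n x) q μ) atTop (𝓝 0)) :
    Tendsto (fun n => ∫ x, f n x * ψ x ∂μ) atTop (𝓝 (∫ x, g x * ψ x ∂μ)) := by
  refine tendsto_integral_of_L1' _ (hg.1.mul hψ.1)
    (.of_forall fun n => memLp_one_iff_integrable.1 (hψ.mul' (hf n))) ?_
  have h0 : Tendsto (fun n => eLpNorm (fun x => g x - f n x) q μ * eLpNorm ψ r μ) atTop (𝓝 0) := by
    simpa using ENNReal.Tendsto.mul_const hlim (Or.inr hψ.2.ne)
  refine tendsto_of_tendsto_of_tendsto_of_le_of_le tendsto_const_nhds h0 (fun _ => zero_le)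
    fun n => ?_
  refine le_trans (le_of_eq ?_)
    (eLpNorm_smul_le_mul_eLpNorm (p := q) (q := r) (r := 1) hψ.1 (hg.1.sub (hf n).1))
  rw [← eLpNorm_neg]
  congr 1
  ext x
  simp [sub_mul]

variable {N : ℕ} {p : ℝ} {q : ℝ≥0∞} {i : Fin N} {Ω Ω' A : Set (EuclideanSpace ℝ (Fin N))}
  {u v φ : EuclideanSpace ℝ (Fin N) → ℝ} {g h : Fin N → EuclideanSpace ℝ (Fin N) → ℝ}

/-- `(u, g)` is a limit in `L^q` of pairs `(φ, ∇φ)` with `φ` smooth and compactly supported. -/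
def IsSmoothLimit (q : ℝ≥0∞) (u : EuclideanSpace ℝ (Fin N) → ℝ)
    (g : Fin N → EuclideanSpace ℝ (Fin N) → ℝ) : Prop :=
  MemLp u q ∧ (∀ i, MemLp (g i) q) ∧ ∀ ε : ℝ≥0∞, 0 < ε →
    ∃ φ : EuclideanSpace ℝ (Fin N) → ℝ, ContDiff ℝ ∞ φ ∧ HasCompactSupport φ ∧
      eLpNorm (fun x => u x - φ x) q ≤ ε ∧
      ∀ i, eLpNorm (fun x => g i x - fderiv ℝ φ x (EuclideanSpace.single i 1)) q ≤ ε

lemma isSmoothLimit_of_contDiff (hφ : ContDiff ℝ ∞ φ) (hc : HasCompactSupport φ) :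
    IsSmoothLimit q φ fun i x => fderiv ℝ φ x (EuclideanSpace.single i 1) :=
  ⟨hφ.continuous.memLp_of_hasCompactSupport hc, fun _ =>
    (continuous_fderiv_apply hφ _).memLp_of_hasCompactSupport (hasCompactSupport_fderiv_apply hc _),
    fun ε _ => ⟨φ, hφ, hc, by simp, by simp⟩⟩

lemma IsSmoothLimit.congr (hu : IsSmoothLimit q u g) (huv : u =ᵐ[volume] v)
    (hgh : ∀ i, g i =ᵐ[volume] h i) : IsSmoothLimit q v h := by
  refine ⟨hu.1.ae_eq huv, fun i => (hu.2.1 i).ae_eq (hgh i), fun ε hε => ?_⟩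
  obtain ⟨φ, hφ, hc, h1, h2⟩ := hu.2.2 ε hε
  refine ⟨φ, hφ, hc, (eLpNorm_congr_ae ?_).trans_le h1, fun i =>
    (eLpNorm_congr_ae ?_).trans_le (h2 i)⟩
  · filter_upwards [huv] with x hx using by rw [hx]
  · filter_upwards [hgh i] with x hx using by rw [hx]

lemma IsSmoothLimit.exists_seq (hu : IsSmoothLimit q u g) :
    ∃ φ : ℕ → EuclideanSpace ℝ (Fin N) → ℝ, (∀ n, ContDiff ℝ ∞ (φ n)) ∧
      (∀ n, HasCompactSupport (φ n)) ∧
      Tendsto (fun n => eLpNorm (fun x => u x - φ n x) q) atTop (𝓝 0) ∧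
      ∀ i, Tendsto (fun n => eLpNorm (fun x => g i x -
        fderiv ℝ (φ n) x (EuclideanSpace.single i 1)) q) atTop (𝓝 0) := by
  -- At `n = 0` the tolerance is `⊤`, which is harmless.
  choose φ hφ hc h1 h2 using fun n : ℕ => hu.2.2 ((n : ℝ≥0∞)⁻¹) (by simp)
  exact ⟨φ, hφ, hc,
    tendsto_of_tendsto_of_tendsto_of_le_of_le tendsto_const_nhds
      ENNReal.tendsto_inv_nat_nhds_zero (fun _ => zero_le) h1, fun i =>
    tendsto_of_tendsto_of_tendsto_of_le_of_le tendsto_const_nhds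
      ENNReal.tendsto_inv_nat_nhds_zero (fun _ => zero_le) fun n => h2 n i⟩

/-- Limits of smooth limits are smooth limits. -/
lemma isSmoothLimit_of_forall_exists (hq : 1 ≤ q) (hu : MemLp u q) (hg : ∀ i, MemLp (g i) q)
    (H : ∀ ε : ℝ≥0∞, 0 < ε → ∃ v h, IsSmoothLimit q v h ∧
      eLpNorm (fun x => u x - v x) q ≤ ε ∧ ∀ i, eLpNorm (fun x => g i x - h i x) q ≤ ε) :
    IsSmoothLimit q u g := by
  refine ⟨hu, hg, fun ε hε => ?_⟩
  obtain ⟨v, h, hv, h1, h2⟩ := H (ε / 2) (ENNReal.half_pos hε.ne')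
  obtain ⟨φ, hφ, hc, h3, h4⟩ := hv.2.2 (ε / 2) (ENNReal.half_pos hε.ne')
  have hφL := isSmoothLimit_of_contDiff (q := q) hφ hc
  refine ⟨φ, hφ, hc, ?_, fun i => ?_⟩
  · have := eLpNorm_add_le (hu.1.sub hv.1.1) (hv.1.1.sub hφL.1.1) hq
    simp only [sub_add_sub_cancel] at this
    exact this.trans ((add_le_add h1 h3).trans_eq (ENNReal.add_halves ε))
  · have := eLpNorm_add_le ((hg i).1.sub (hv.2.1 i).1) ((hv.2.1 i).1.sub (hφL.2.1 i).1) hq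
    simp only [sub_add_sub_cancel] at this
    exact this.trans ((add_le_add (h2 i) (h4 i)).trans_eq (ENNReal.add_halves ε))

lemma IsSmoothLimit.add (hq : 1 ≤ q) (hu : IsSmoothLimit q u g) (hv : IsSmoothLimit q v h) :
    IsSmoothLimit q (u + v) (g + h) := by
  refine ⟨hu.1.add hv.1, fun i => (hu.2.1 i).add (hv.2.1 i), fun ε hε => ?_⟩
  obtain ⟨φ, hφ, hφc, h1, h2⟩ := hu.2.2 (ε / 2) (ENNReal.half_pos hε.ne')
  obtain ⟨ψ, hψ, hψc, h3, h4⟩ := hv.2.2 (ε / 2) (ENNReal.half_pos hε.ne')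
  have hφL := isSmoothLimit_of_contDiff (q := q) hφ hφc
  have hψL := isSmoothLimit_of_contDiff (q := q) hψ hψc
  refine ⟨φ + ψ, hφ.add hψ, hφc.add hψc, ?_, fun i => ?_⟩
  · have := eLpNorm_add_le (hu.1.1.sub hφL.1.1) (hv.1.1.sub hψL.1.1) hq
    refine le_trans (le_of_eq ?_)
      (this.trans ((add_le_add h1 h3).trans_eq (ENNReal.add_halves ε)))
    congr 1
    ext x
    simp only [Pi.add_apply, Pi.sub_apply]
    ring
  · have := eLpNorm_add_le ((hu.2.1 i).1.sub (hφL.2.1 i).1) ((hv.2.1 i).1.sub (hψL.2.1 i).1) hq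
    refine le_trans (le_of_eq ?_)
      (this.trans ((add_le_add (h2 i) (h4 i)).trans_eq (ENNReal.add_halves ε)))
    congr 1
    ext x
    rw [fderiv_add (hφ.differentiable (by simp) x) (hψ.differentiable (by simp) x)]
    simp only [Pi.add_apply, Pi.sub_apply, add_apply]
    ring

/-- Smooth limits are weakly differentiable on the whole space. -/
lemma IsSmoothLimit.isWeakPartial (hq : 1 ≤ q) (hu : IsSmoothLimit q u g) (i : Fin N) :
    IsWeakPartial Set.univ i u (g i) := by
  refine .of_integral_eq ((hu.1.locallyIntegrable hq).locallyIntegrableOn _)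
    (((hu.2.1 i).locallyIntegrable hq).locallyIntegrableOn _) fun ψ hψ hψc _ => ?_
  obtain ⟨φ, hφ, hc, h1, h2⟩ := hu.exists_seq
  have : Fact (1 ≤ q) := ⟨hq⟩
  have hφL n := isSmoothLimit_of_contDiff (q := q) (hφ n) (hc n)
  have hψL := isSmoothLimit_of_contDiff (q := ENNReal.conjExponent q) hψ hψc
  have : ENNReal.HolderTriple q (ENNReal.conjExponent q) 1 := ENNReal.HolderConjugate.conjExponent hq
  have t1 := tendsto_integral_mul_of_tendsto_eLpNorm (fun n => (hφL n).1) hu.1 (hψL.2.1 i) h1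
  have t2 := tendsto_integral_mul_of_tendsto_eLpNorm (fun n => (hφL n).2.1 i) (hu.2.1 i) hψL.1 (h2 i)
  -- Integration by parts holds for each smooth approximant, and both sides converge by Hölder.
  refine tendsto_nhds_unique t1 (t2.neg.congr fun n => (?_ : _ = _))
  refine (integral_mul_fderiv_eq_neg_fderiv_mul_of_integrable ?_ ?_ ?_
    (fun x _ => (hφ n).differentiable (by simp) x) fun x _ => hψ.differentiable (by simp) x).symm
  · exact ((continuous_fderiv_apply (hφ n) _).mul hψ.continuous).integrable_of_hasCompactSupport
      hψc.mul_left
  · exact ((hφ n).continuous.mul (continuous_fderiv_apply hψ _)).integrable_of_hasCompactSupport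
      (hc n).mul_right
  · exact ((hφ n).continuous.mul hψ.continuous).integrable_of_hasCompactSupport hψc.mul_left

lemma IsSmoothLimit.memW (hp : 1 ≤ p) (hu : IsSmoothLimit (ENNReal.ofReal p) u g) :
    MemW p Set.univ u := by
  have hq : 1 ≤ ENNReal.ofReal p := by simpa
  exact ⟨by simpa using hu.1, fun i => ⟨g i, hu.isWeakPartial hq i, by simpa using hu.2.1 i⟩⟩

lemma normPow_univ_le {ε : ℝ≥0∞} (hp : 0 ≤ p) (hg : ∀ i, IsWeakPartial Set.univ i u (g i))
    (h0 : eLpNorm u (ENNReal.ofReal p) ≤ ε) (h1 : ∀ i, eLpNorm (g i) (ENNReal.ofReal p) ≤ ε) :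
    normPow p Set.univ u ≤ (N + 1) * ε ^ p := by
  rw [normPow_eq isOpen_univ hg, Measure.restrict_univ]
  calc _ ≤ ε ^ p + ∑ _i : Fin N, ε ^ p := by
        gcongr with i
        exact h1 i
    _ = _ := by simp; ring

/-- Supplies the tolerance for `normPow_univ_le`: the function and its `N` derivatives contribute at
most `δ ^ p` each. -/
lemma exists_pos_mul_rpow_lt (hp : 0 < p) {ε : ℝ≥0∞} (hε : 0 < ε) (N : ℕ) :
    ∃ δ : ℝ≥0∞, 0 < δ ∧ δ ≠ ⊤ ∧ (N + 1) * δ ^ p < ε := by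
  have h1 : Tendsto (fun δ : ℝ≥0∞ => ((N : ℝ≥0∞) + 1) * δ ^ p) (𝓝[>] 0) (𝓝 0) := by
    have h2 : Tendsto (fun δ : ℝ≥0∞ => δ ^ p) (𝓝[>] 0) (𝓝 0) := by
      have := (ENNReal.continuous_rpow_const (y := p)).tendsto 0
      rw [ENNReal.zero_rpow_of_pos hp] at this
      exact this.mono_left nhdsWithin_le_nhds
    simpa using ENNReal.Tendsto.const_mul h2 (Or.inr (by finiteness))
  have h3 : ∀ᶠ δ : ℝ≥0∞ in 𝓝[>] 0, δ < 1 :=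
    nhdsWithin_le_nhds (eventually_lt_nhds zero_lt_one)
  obtain ⟨δ, ⟨hδ, hδ1⟩, hδ0⟩ :=
    ((h1.eventually (gt_mem_nhds hε)).and h3 |>.and self_mem_nhdsWithin).exists
  exact ⟨δ, hδ0, hδ1.ne_top, hδ⟩

lemma IsSmoothLimit.memWTilde (hp : 1 ≤ p) (hu : IsSmoothLimit (ENNReal.ofReal p) u g) :
    MemWTilde p Set.univ u := by
  have hq : 1 ≤ ENNReal.ofReal p := by simpa
  refine ⟨hu.memW hp, fun ε hε => ?_⟩
  obtain ⟨δ, hδ, -, hδε⟩ := exists_pos_mul_rpow_lt (zero_lt_one.trans_le hp) hε N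
  obtain ⟨φ, hφ, hc, h1, h2⟩ := hu.2.2 δ hδ
  have hφL := isSmoothLimit_of_contDiff (q := ENNReal.ofReal p) hφ hc
  refine ⟨φ, ⟨hφ.continuous.continuousOn, tsupport φ, hc, by simp, fun x hx =>
    image_eq_zero_of_notMem_tsupport hx.2⟩, hφL.memW hp, lt_of_le_of_lt ?_ hδε⟩
  exact normPow_univ_le (by linarith) (fun i => (hu.isWeakPartial hq i).sub (hφL.isWeakPartial hq i))
    h1 h2

/-- Chain rule for smooth limits and smooth functions with bounded derivative. -/
lemma IsSmoothLimit.comp (hq : 1 ≤ q) (hq' : q ≠ ⊤) (hu : IsSmoothLimit q u g) {f : ℝ → ℝ}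
    (hf : ContDiff ℝ ∞ f) (hf0 : f 0 = 0) {C : ℝ} (hC : ∀ t, ‖deriv f t‖ ≤ C) :
    IsSmoothLimit q (fun x => f (u x)) fun i x => deriv f (u x) * g i x := by
  have hq0 : q ≠ 0 := (zero_lt_one.trans_le hq).ne'
  have hlip a b : ‖f a - f b‖ ≤ C * ‖a - b‖ :=
    convex_univ.norm_image_sub_le_of_norm_deriv_le (fun x _ => hf.differentiable (by simp) x)
      (fun x _ => hC x) (Set.mem_univ _) (Set.mem_univ _)
  have hf' : Continuous (deriv f) := hf.continuous_deriv (by simp)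
  have hfu : MemLp (fun x => f (u x)) q :=
    MemLp.of_le_mul hu.1 (hf.continuous.comp_aestronglyMeasurable hu.1.1)
      (ae_of_all _ fun x => by simpa [hf0] using hlip (u x) 0)
  have hgu i : MemLp (fun x => deriv f (u x) * g i x) q :=
    MemLp.of_le_mul (hu.2.1 i) ((hf'.comp_aestronglyMeasurable hu.1.1).mul (hu.2.1 i).1)
      (ae_of_all _ fun x => by
        rw [norm_mul]
        exact mul_le_mul_of_nonneg_right (hC _) (norm_nonneg _))
  refine ⟨hfu, hgu, fun ε hε => ?_⟩
  obtain ⟨φ', hφ', hc', h1', h2'⟩ := hu.exists_seq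
  -- A subsequence converges almost everywhere, so that `deriv f (φ n x)` tends to `deriv f (u x)`
  -- and dominated convergence applies.
  obtain ⟨ns, hns, hae⟩ := (tendstoInMeasure_of_tendsto_eLpNorm (μ := volume) hq0
    (fun n => (hφ' n).continuous.aestronglyMeasurable) hu.1.1
    (h1'.congr fun n => eLpNorm_sub_comm _ _ _ _)).exists_seq_tendsto_ae
  set φ := fun n => φ' (ns n)
  have hφ n : ContDiff ℝ ∞ (φ n) := hφ' _
  have hc n : HasCompactSupport (φ n) := hc' _
  have h1 := h1'.comp hns.tendsto_atTop
  have h2 i := (h2' i).comp hns.tendsto_atTop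
  have hφL n := isSmoothLimit_of_contDiff (q := q) (hφ n) (hc n)
  have e1 : ∀ᶠ n in atTop, eLpNorm (fun x => f (u x) - f (φ n x)) q ≤ ε := by
    have : Tendsto (fun n => ENNReal.ofReal C * eLpNorm (fun x => u x - φ n x) q) atTop (𝓝 0) := by
      simpa using ENNReal.Tendsto.const_mul h1 (Or.inr (by finiteness))
    filter_upwards [this.eventually (gt_mem_nhds hε)] with n hn
    exact (eLpNorm_le_mul_eLpNorm_of_ae_le_mul (ae_of_all _ fun x => hlip _ _) q).trans hn.le
  have e2 i : ∀ᶠ n in atTop, eLpNorm (fun x => deriv f (u x) * g i x -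
      fderiv ℝ (fun x => f (φ n x)) x (EuclideanSpace.single i 1)) q ≤ ε := by
    have t1 : Tendsto (fun n => ENNReal.ofReal C * eLpNorm (fun x => g i x -
        fderiv ℝ (φ n) x (EuclideanSpace.single i 1)) q) atTop (𝓝 0) := by
      simpa using ENNReal.Tendsto.const_mul (h2 i) (Or.inr (by finiteness))
    have m n : AEStronglyMeasurable (fun x => deriv f (u x) - deriv f (φ n x)) :=
      (hf'.comp_aestronglyMeasurable hu.1.1).sub
        (hf'.comp (hφ n).continuous).aestronglyMeasurable
    have t2 := tendsto_eLpNorm_mul_of_dominated (C := C + C) hq0 hq' m (hu.2.1 i)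
      (fun n x => (norm_sub_le _ _).trans (add_le_add (hC _) (hC _))) (by
        filter_upwards [hae] with x hx
        simpa using ((hf'.tendsto _).comp hx).const_sub (deriv f (u x)))
    have t3 := t1.add t2
    rw [add_zero] at t3
    filter_upwards [t3.eventually (gt_mem_nhds hε)] with n hn
    refine le_trans ?_ hn.le
    have d x : fderiv ℝ (fun x => f (φ n x)) x (EuclideanSpace.single i 1) =
        deriv f (φ n x) * fderiv ℝ (φ n) x (EuclideanSpace.single i 1) := by
      have := ((hf.differentiable (by simp) (φ n x)).hasDerivAt.comp_hasFDerivAt x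
        ((hφ n).differentiable (by simp) x).hasFDerivAt).fderiv
      change fderiv ℝ (f ∘ φ n) x _ = _
      rw [this]
      rfl
    -- The first summand is controlled by the bound on `deriv f`, the second by dominated
    -- convergence with the bound `C + C`.
    have s : (fun x => deriv f (u x) * g i x -
        fderiv ℝ (fun x => f (φ n x)) x (EuclideanSpace.single i 1)) =
        (fun x => deriv f (φ n x) * (g i x - fderiv ℝ (φ n) x (EuclideanSpace.single i 1))) +
        fun x => (deriv f (u x) - deriv f (φ n x)) * g i x := by
      ext x
      simp only [d, Pi.add_apply]
      ring
    rw [s]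
    refine (eLpNorm_add_le ((hf'.comp (hφ n).continuous).aestronglyMeasurable.mul
      ((hu.2.1 i).1.sub ((hφL n).2.1 i).1)) ((m n).mul (hu.2.1 i).1) hq).trans ?_
    refine add_le_add
      (eLpNorm_le_mul_eLpNorm_of_ae_le_mul (ae_of_all _ fun x => ?_) q) le_rfl
    change ‖deriv f (φ n x) * _‖ ≤ _
    rw [norm_mul]
    exact mul_le_mul_of_nonneg_right (hC _) (norm_nonneg _)
  obtain ⟨n, hn1, hn2⟩ := (e1.and (eventually_all.2 e2)).exists
  exact ⟨_, hf.comp (hφ n), (hc n).comp_left hf0, hn1, hn2⟩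

/-- Nonnegative smooth limits with summable norms are dominated by a single smooth limit. -/
lemma exists_isSmoothLimit_ge (hq : 1 ≤ q) {u : ℕ → EuclideanSpace ℝ (Fin N) → ℝ}
    {g : ℕ → Fin N → EuclideanSpace ℝ (Fin N) → ℝ} (hu : ∀ n, IsSmoothLimit q (u n) (g n))
    (hpos : ∀ n x, 0 ≤ u n x) {δ : ℕ → ℝ≥0∞} (h0 : ∀ n, eLpNorm (u n) q ≤ δ n)
    (h1 : ∀ n i, eLpNorm (g n i) q ≤ δ n) (hδ : ∑' n, δ n ≠ ⊤) :
    ∃ w h, IsSmoothLimit q w h ∧ (∀ᵐ x, ∀ n, u n x ≤ w x) ∧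
      eLpNorm w q ≤ ∑' n, δ n ∧ ∀ i, eLpNorm (h i) q ≤ ∑' n, δ n := by
  have : Fact (1 ≤ q) := ⟨hq⟩
  let U n := (hu n).1.toLp
  let D i n := ((hu n).2.1 i).toLp
  have hU : ∑' n, ‖U n‖ₑ ≤ ∑' n, δ n := ENNReal.tsum_le_tsum fun n => by
    simpa [U, Lp.enorm_toLp] using h0 n
  have hD i : ∑' n, ‖D i n‖ₑ ≤ ∑' n, δ n := ENNReal.tsum_le_tsum fun n => by
    simpa [D, Lp.enorm_toLp] using h1 n i
  have hU' := ne_top_of_le_ne_top hδ hU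
  have hD' i := ne_top_of_le_ne_top hδ (hD i)
  -- Absolutely summable series converge in `L^q`, so it is enough that the partial sums are smooth
  -- limits.
  have hfin (n : ℕ) : IsSmoothLimit q (∑ k ∈ Finset.range n, U k : Lp ℝ q)
      fun i => (∑ k ∈ Finset.range n, D i k : Lp ℝ q) := by
    induction n with
    | zero =>
      refine (isSmoothLimit_of_contDiff (φ := 0) contDiff_const .zero).congr ?_ fun i => ?_
      · simpa using (Lp.coeFn_zero ℝ q volume).symm
      · filter_upwards with x using by simp
    | succ n ih =>
      refine (ih.add hq (hu n)).congr ?_ fun i => ?_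
      · rw [Finset.sum_range_succ]
        filter_upwards [Lp.coeFn_add (∑ k ∈ Finset.range n, U k) (U n), (hu n).1.coeFn_toLp]
          with x hx hx'
        rw [hx, Pi.add_apply, Pi.add_apply, hx']
      · rw [Finset.sum_range_succ]
        filter_upwards [Lp.coeFn_add (∑ k ∈ Finset.range n, D i k) (D i n),
          ((hu n).2.1 i).coeFn_toLp] with x hx hx'
        rw [hx, Pi.add_apply, Pi.add_apply, Pi.add_apply, hx']
  refine ⟨(∑' n, U n : Lp ℝ q), fun i => (∑' n, D i n : Lp ℝ q), ?_, ?_, ?_, fun i => ?_⟩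
  · refine isSmoothLimit_of_forall_exists hq (Lp.memLp _) (fun i => Lp.memLp _) fun ε hε => ?_
    have t0 := (tendsto_iff_edist_tendsto_0.1 (Summable.of_enorm hU').tendsto_sum_tsum_nat).eventually
      (gt_mem_nhds hε)
    have t1 i := (tendsto_iff_edist_tendsto_0.1
      (Summable.of_enorm (hD' i)).tendsto_sum_tsum_nat).eventually (gt_mem_nhds hε)
    obtain ⟨n, hn0, hn1⟩ := (t0.and (eventually_all.2 t1)).exists
    refine ⟨_, _, hfin n, ?_, fun i => ?_⟩
    · rw [edist_comm, Lp.edist_def] at hn0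
      exact hn0.le
    · have := hn1 i
      rw [edist_comm, Lp.edist_def] at this
      exact this.le
  · filter_upwards [Lp.hasSum_coeFn_tsum hU', ae_all_iff.2 fun n => (hu n).1.coeFn_toLp]
      with x hx hx' n
    rw [← hx' n]
    exact le_hasSum hx n fun k _ => by rw [hx' k]; exact hpos k x
  · rw [← Lp.enorm_def]
    exact enorm_tsum_le_tsum_enorm.trans hU
  · rw [← Lp.enorm_def]
    exact enorm_tsum_le_tsum_enorm.trans (hD i)

end

/-! ### Cutoffs and mollification -/

section

open Filter Topology

variable {N : ℕ} {p : ℝ} {q : ℝ≥0∞} {i : Fin N} {Ω A : Set (EuclideanSpace ℝ (Fin N))}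
  {u v g η φ : EuclideanSpace ℝ (Fin N) → ℝ} {h : Fin N → EuclideanSpace ℝ (Fin N) → ℝ}

/-- The product vanishes outside `Ω`, so it equals its own indicator and only the norm of `u` on `Ω`
enters. -/
lemma memLp_mul_of_tsupport_subset (hΩ : IsOpen Ω) (hu : MemLp u q (volume.restrict Ω))
    (hφ : Continuous φ) {C : ℝ} (hC : ∀ x, ‖φ x‖ ≤ C) (hs : tsupport φ ⊆ Ω) :
    MemLp (fun x => u x * φ x) q ∧
      eLpNorm (fun x => u x * φ x) q ≤ ENNReal.ofReal C * eLpNorm u q (volume.restrict Ω) := by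
  have hle : ∀ᵐ x ∂volume.restrict Ω, ‖u x * φ x‖ ≤ C * ‖u x‖ := ae_of_all _ fun x => by
    rw [norm_mul, mul_comm]
    exact mul_le_mul_of_nonneg_right (hC x) (norm_nonneg _)
  have hind : Ω.indicator (fun x => u x * φ x) = fun x => u x * φ x := by
    refine Set.indicator_eq_self.2 fun x hx => hs ?_
    by_contra hx'
    exact hx (by simp [image_eq_zero_of_notMem_tsupport hx'])
  rw [← hind, memLp_indicator_iff_restrict hΩ.measurableSet,
    eLpNorm_indicator_eq_eLpNorm_restrict hΩ.measurableSet]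
  exact ⟨MemLp.of_le_mul hu (hu.1.mul hφ.aestronglyMeasurable) hle,
    eLpNorm_le_mul_eLpNorm_of_ae_le_mul hle q⟩

/-- Product rule: multiplication by a smooth function with compact support in `Ω` gives a weakly
differentiable function on the whole space. -/
lemma IsWeakPartial.mul_cutoff (hu : IsWeakPartial Ω i u g) (hη : ContDiff ℝ ∞ η)
    (hc : HasCompactSupport η) (hs : tsupport η ⊆ Ω) :
    IsWeakPartial Set.univ i (fun x => u x * η x)
      (fun x => g x * η x + u x * fderiv ℝ η x (EuclideanSpace.single i 1)) := by
  have hs' := (tsupport_fderiv_apply_subset η (EuclideanSpace.single i 1)).trans hs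
  have hc' := hasCompactSupport_fderiv_apply hc (EuclideanSpace.single i 1)
  have hη' := continuous_fderiv_apply hη (EuclideanSpace.single i 1)
  have i1 := integrable_mul_of_tsupport_subset hu.1 hη.continuous hc hs
  have i2 := integrable_mul_of_tsupport_subset hu.2.1 hη.continuous hc hs
  have i3 := integrable_mul_of_tsupport_subset hu.1 hη' hc' hs'
  refine .of_integral_eq (i1.locallyIntegrable.locallyIntegrableOn _)
    ((i2.add i3).locallyIntegrable.locallyIntegrableOn _) fun φ hφ hφc _ => ?_
  have hφ' := continuous_fderiv_apply hφ (EuclideanSpace.single i 1)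
  have hsη : tsupport (fun x => η x * φ x) ⊆ Ω := (tsupport_mul_subset_left).trans hs
  -- `η φ` is an admissible test function on `Ω`, although `φ` need not be.
  have key := hu.integral_eq (hη.mul hφ) hc.mul_right hsη
  have d x : fderiv ℝ (fun x => η x * φ x) x (EuclideanSpace.single i 1) =
      η x * fderiv ℝ φ x (EuclideanSpace.single i 1) +
        fderiv ℝ η x (EuclideanSpace.single i 1) * φ x := by
    rw [fderiv_fun_mul (hη.differentiable (by simp) x) (hφ.differentiable (by simp) x)]
    simp [mul_comm]
  have j1 : Integrable fun x => u x * (η x * fderiv ℝ φ x (EuclideanSpace.single i 1)) :=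
    integrable_mul_of_tsupport_subset hu.1 (hη.continuous.mul hφ') hc.mul_right
      ((tsupport_mul_subset_left).trans hs)
  have j2 : Integrable fun x => u x * (fderiv ℝ η x (EuclideanSpace.single i 1) * φ x) :=
    integrable_mul_of_tsupport_subset hu.1 (hη'.mul hφ.continuous) hc'.mul_right
      ((tsupport_mul_subset_left).trans hs')
  have j3 : Integrable fun x => g x * (η x * φ x) :=
    integrable_mul_of_tsupport_subset hu.2.1 (hη.continuous.mul hφ.continuous) hc.mul_right hsη
  simp only [d, mul_add] at key
  rw [integral_add j1 j2] at key
  simp only [add_mul, mul_assoc]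
  rw [integral_add j3 j2]
  linarith

/-- Translations are continuous in `L^q`. -/
lemma eventually_eLpNorm_sub_translate_le (hq : 1 ≤ q) (hq' : q ≠ ⊤) (hv : MemLp v q)
    {ε : ℝ≥0∞} (hε : 0 < ε) :
    ∀ᶠ t in 𝓝 (0 : EuclideanSpace ℝ (Fin N)), eLpNorm (fun x => v x - v (x - t)) q ≤ ε := by
  have : Fact (1 ≤ q) := ⟨hq⟩
  have : Fact (q ≠ ⊤) := ⟨hq'⟩
  have hcont : Continuous fun t : EuclideanSpace ℝ (Fin N) =>
      DomAddAct.mk (-t) +ᵥ hv.toLp v :=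
    (DomAddAct.continuous_mk.comp continuous_neg).vadd continuous_const
  have h0 := tendsto_iff_edist_tendsto_0.1 (hcont.tendsto 0)
  filter_upwards [h0.eventually (gt_mem_nhds hε)] with t ht
  rw [neg_zero, DomAddAct.mk_zero, zero_vadd, edist_comm, DomAddAct.mk_vadd_toLp,
    Lp.edist_toLp_toLp] at ht
  refine le_trans (le_of_eq ?_) ht.le
  congr 1
  ext x
  simp [neg_add_eq_sub]

/-- Averages of translates are close in `L^q` if the translates are. -/
lemma eLpNorm_sub_convolution_le (hq : 1 ≤ q) (hq' : q ≠ ⊤) (hv : MemLp v q)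
    (ρ : ContDiffBump (0 : EuclideanSpace ℝ (Fin N))) {ε : ℝ≥0∞}
    (hε : ∀ t ∈ Metric.ball 0 ρ.rOut, eLpNorm (fun x => v x - v (x - t)) q ≤ ε) :
    eLpNorm (fun x => v x -
      convolution (ρ.normed volume) v (ContinuousLinearMap.lsmul ℝ ℝ) volume x) q ≤ ε := by
  -- A Borel representative gives the joint measurability needed for Tonelli at the end.
  wlog hm : Measurable v generalizing v
  · set w := hv.1.mk v
    have hvw : v =ᵐ[volume] w := hv.1.ae_eq_mk
    have := this (hv.ae_eq hvw) (fun t ht => ?_) hv.1.stronglyMeasurable_mk.measurable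
    · refine le_trans (le_of_eq (eLpNorm_congr_ae ?_)) this
      filter_upwards [hvw] with x hx
      rw [hx, convolution_congr _ (ae_eq_refl (ρ.normed volume)) hvw]
    · refine le_trans (le_of_eq (eLpNorm_congr_ae ?_)) (hε t ht)
      have := (measurePreserving_sub_right volume t).quasiMeasurePreserving.ae_eq_comp hvw
      filter_upwards [hvw, this] with x hx hx'
      simp only [Function.comp_apply] at hx'
      rw [hx, hx']
  have hq0 : q ≠ 0 := (zero_lt_one.trans_le hq).ne'
  have hqr : 0 < q.toReal := ENNReal.toReal_pos hq0 hq'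
  have hρm : Measurable fun t => ENNReal.ofReal (ρ.normed volume t) :=
    ρ.continuous_normed.measurable.ennreal_ofReal
  -- The mollifier is the density of a probability measure, so the difference is an average of `v x
  -- - v (x - t)`. Monotonicity of `L^q` norms in the exponent then gives the Jensen-type bound
  -- `hpt`.
  set ν : Measure (EuclideanSpace ℝ (Fin N)) :=
    volume.withDensity fun t => ENNReal.ofReal (ρ.normed volume t) with hν
  have hνp : IsProbabilityMeasure ν := ⟨by
    rw [hν, withDensity_apply _ .univ, Measure.restrict_univ,
      ← ofReal_integral_eq_lintegral_ofReal ρ.integrable_normed (ae_of_all _ ρ.nonneg_normed),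
      ρ.integral_normed, ENNReal.ofReal_one]⟩
  have hνi (f : EuclideanSpace ℝ (Fin N) → ℝ) :
      ∫ t, f t ∂ν = ∫ t, ρ.normed volume t * f t := by
    rw [hν, integral_withDensity_eq_integral_toReal_smul hρm (ae_of_all _ fun _ => by simp)]
    simp [ENNReal.toReal_ofReal (ρ.nonneg_normed _)]
  have hpt x : ‖v x - convolution (ρ.normed volume) v (ContinuousLinearMap.lsmul ℝ ℝ) volume x‖ₑ
      ^ q.toReal ≤ ∫⁻ t, ‖v x - v (x - t)‖ₑ ^ q.toReal ∂ν := by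
    have hex : Integrable fun t => ρ.normed volume t * v (x - t) :=
      (ρ.hasCompactSupport_normed.convolutionExists_left (ContinuousLinearMap.lsmul ℝ ℝ)
        ρ.continuous_normed (hv.locallyIntegrable hq) x).integrable
    have heq : v x - convolution (ρ.normed volume) v (ContinuousLinearMap.lsmul ℝ ℝ) volume x =
        ∫ t, (v x - v (x - t)) ∂ν := by
      rw [hνi]
      simp only [mul_sub]
      rw [integral_sub (ρ.integrable_normed.mul_const _) hex, integral_mul_const,
        ρ.integral_normed, one_mul]
      rfl
    have hms : Measurable fun t => v x - v (x - t) :=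
      measurable_const.sub (hm.comp (measurable_const.sub measurable_id))
    have h1 : ‖∫ t, (v x - v (x - t)) ∂ν‖ₑ ≤ eLpNorm (fun t => v x - v (x - t)) q ν :=
      (enorm_integral_le_lintegral_enorm _).trans (by
        rw [← eLpNorm_one_eq_lintegral_enorm]
        exact eLpNorm_le_eLpNorm_of_exponent_le hq hms.aestronglyMeasurable)
    rw [heq]
    refine (ENNReal.rpow_le_rpow h1 hqr.le).trans_eq ?_
    rw [eLpNorm_eq_lintegral_rpow_enorm_toReal hq0 hq', ← ENNReal.rpow_mul,
      one_div_mul_cancel hqr.ne', ENNReal.rpow_one]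
  have hfin : ∀ᵐ t ∂ν, ∫⁻ x, ‖v x - v (x - t)‖ₑ ^ q.toReal ≤ ε ^ q.toReal := by
    rw [hν, ae_withDensity_iff hρm]
    refine ae_of_all _ fun t ht => ?_
    have htb : t ∈ Metric.ball 0 ρ.rOut := by
      rw [← ρ.support_normed_eq (μ := volume)]
      intro h0
      exact ht (by simp [h0])
    refine le_trans (le_of_eq ?_) (ENNReal.rpow_le_rpow (hε t htb) hqr.le)
    rw [eLpNorm_eq_lintegral_rpow_enorm_toReal hq0 hq', ← ENNReal.rpow_mul,
      one_div_mul_cancel hqr.ne', ENNReal.rpow_one]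
  rw [eLpNorm_eq_lintegral_rpow_enorm_toReal hq0 hq', one_div,
    ENNReal.rpow_inv_le_iff hqr]
  refine (lintegral_mono hpt).trans ?_
  rw [lintegral_lintegral_swap]
  · exact (lintegral_mono_ae hfin).trans (by simp)
  · exact (((hm.comp measurable_fst).sub
      (hm.comp (measurable_fst.sub measurable_snd))).enorm.pow_const _).aemeasurable

/-- Mollifying a weakly differentiable function commutes with taking the derivative. -/
lemma IsWeakPartial.fderiv_convolution (hv : IsWeakPartial Set.univ i v g)
    {ρ : EuclideanSpace ℝ (Fin N) → ℝ} (hρ : ContDiff ℝ ∞ ρ) (hc : HasCompactSupport ρ)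
    (x : EuclideanSpace ℝ (Fin N)) :
    fderiv ℝ (convolution ρ v (ContinuousLinearMap.lsmul ℝ ℝ) volume) x
      (EuclideanSpace.single i 1) =
      convolution ρ g (ContinuousLinearMap.lsmul ℝ ℝ) volume x := by
  have hloc : LocallyIntegrable v := locallyIntegrableOn_univ.1 hv.1
  have hρ1 : ContDiff ℝ 1 ρ := hρ.of_le (by simp)
  rw [(hc.hasFDerivAt_convolution_left (ContinuousLinearMap.lsmul ℝ ℝ) hρ1 hloc x).fderiv]
  have hex := (hc.fderiv ℝ).convolutionExists_left
    ((ContinuousLinearMap.lsmul ℝ ℝ : ℝ →L[ℝ] ℝ →L[ℝ] ℝ).precompL (EuclideanSpace ℝ (Fin N)))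
    (hρ1.continuous_fderiv one_ne_zero) hloc x
  rw [convolution_eq_swap, convolution_eq_swap, ContinuousLinearMap.integral_apply]
  rotate_left
  · exact hex.integrable_swap
  -- Test with `y ↦ ρ (x - y)`: the sign from the reflection cancels the sign in the weak
  -- derivative.
  have hψ : ContDiff ℝ ∞ fun y => ρ (x - y) := hρ.comp (contDiff_const.sub contDiff_id)
  have hψc : HasCompactSupport fun y => ρ (x - y) :=
    hc.comp_homeomorph (Homeomorph.subLeft x)
  have key := hv.integral_eq hψ hψc (Set.subset_univ _)
  have d y : fderiv ℝ (fun y => ρ (x - y)) y (EuclideanSpace.single i 1) =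
      -fderiv ℝ ρ (x - y) (EuclideanSpace.single i 1) := by
    have h1 := (hρ.differentiable (by simp) (x - y)).hasFDerivAt.comp y
      ((hasFDerivAt_id y).const_sub x)
    change fderiv ℝ (ρ ∘ HSub.hSub x) y _ = _
    rw [h1.fderiv]
    simp
  simp only [d, mul_neg, integral_neg, neg_inj] at key
  simpa [mul_comm] using key

/-- A compactly supported Sobolev function on the whole space is a limit of smooth functions. -/
lemma isSmoothLimit_of_isWeakPartial (hq : 1 ≤ q) (hq' : q ≠ ⊤) (hv : MemLp v q)
    (hh : ∀ i, MemLp (h i) q) (hc : HasCompactSupport v)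
    (hw : ∀ i, IsWeakPartial Set.univ i v (h i)) : IsSmoothLimit q v h := by
  refine ⟨hv, hh, fun ε hε => ?_⟩
  obtain ⟨r, hr, hball⟩ := Metric.eventually_nhds_iff_ball.1
    ((eventually_eLpNorm_sub_translate_le hq hq' hv hε).and
      (eventually_all.2 fun i => eventually_eLpNorm_sub_translate_le hq hq' (hh i) hε))
  let ρ : ContDiffBump (0 : EuclideanSpace ℝ (Fin N)) := ⟨r / 2, r, half_pos hr, half_lt_self hr⟩
  refine ⟨_, ρ.hasCompactSupport_normed.contDiff_convolution_left (ContinuousLinearMap.lsmul ℝ ℝ)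
    ρ.contDiff_normed (hv.locallyIntegrable hq), ρ.hasCompactSupport_normed.convolution _ hc,
    eLpNorm_sub_convolution_le hq hq' hv ρ fun t ht => (hball t ht).1, fun i => ?_⟩
  simp only [(hw i).fderiv_convolution ρ.contDiff_normed ρ.hasCompactSupport_normed]
  exact eLpNorm_sub_convolution_le hq hq' (hh i) ρ fun t ht => (hball t ht).2 i

end

/-! ### Localization and gluing of admissible functions -/

section

open Filter Topology

variable {N : ℕ} {p : ℝ} {Ω A : Set (EuclideanSpace ℝ (Fin N))}
  {η : EuclideanSpace ℝ (Fin N) → ℝ}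

/-- A non-empty open set is covered by countably many open sets on each of which some smooth
cutoff function with compact support in the given set equals one. -/
lemma exists_cutoff_seq (hΩ : IsOpen Ω) (hne : Ω.Nonempty) :
    ∃ (η : ℕ → EuclideanSpace ℝ (Fin N) → ℝ) (W : ℕ → Set (EuclideanSpace ℝ (Fin N))),
      (∀ n, ContDiff ℝ ∞ (η n)) ∧ (∀ n, HasCompactSupport (η n)) ∧ (∀ n, tsupport (η n) ⊆ Ω) ∧
      (∀ n, IsOpen (W n)) ∧ (∀ n, ∀ x ∈ W n, η n x = 1) ∧ Ω ⊆ ⋃ n, W n := by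
  have hb (x : Ω) : ∃ b : ContDiffBump (x : EuclideanSpace ℝ (Fin N)),
      Metric.closedBall x.1 b.rOut ⊆ Ω := by
    obtain ⟨r, hr, hrΩ⟩ := Metric.nhds_basis_closedBall.mem_iff.1 (hΩ.mem_nhds x.2)
    exact ⟨⟨r / 2, r, half_pos hr, half_lt_self hr⟩, hrΩ⟩
  choose b hb using hb
  -- The Lindelöf property extracts a countable subcover.
  obtain ⟨T, hT, hTU⟩ := TopologicalSpace.isOpen_iUnion_countable
    (fun x : Ω => Metric.ball x.1 (b x).rIn) fun _ => Metric.isOpen_ball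
  have hcov : Ω ⊆ ⋃ x ∈ T, Metric.ball (x : Ω).1 (b x).rIn := by
    rw [hTU]
    exact fun x hx => Set.mem_iUnion.2 ⟨⟨x, hx⟩, Metric.mem_ball_self (b _).rIn_pos⟩
  have hTne : T.Nonempty := by
    obtain ⟨y, hy⟩ := hne
    obtain ⟨x, hx, -⟩ := Set.mem_iUnion₂.1 (hcov hy)
    exact ⟨x, hx⟩
  obtain ⟨c, rfl⟩ := hT.exists_eq_range hTne
  refine ⟨fun n => b (c n), fun n => Metric.ball (c n).1 (b (c n)).rIn,
    fun n => (b (c n)).contDiff, fun n => (b (c n)).hasCompactSupport,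
    fun n => (b (c n)).tsupport_eq.trans_subset (hb _), fun _ => Metric.isOpen_ball,
    fun n x hx => (b (c n)).one_of_mem_closedBall (Metric.ball_subset_closedBall hx), ?_⟩
  simpa only [Set.biUnion_range] using hcov

/-- This function is a smooth replacement for truncation: nonnegative, zero at 0, of bounded slope,
and at least 1 wherever `t ≥ 1`. -/
lemma hasDerivAt_two_mul_sq_div (t : ℝ) :
    HasDerivAt (fun t : ℝ => 2 * t ^ 2 / (1 + t ^ 2)) (4 * t / (1 + t ^ 2) ^ 2) t := by
  have h0 : 1 + t ^ 2 ≠ 0 := by positivity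
  convert! (((hasDerivAt_pow 2 t).const_mul 2).div ((hasDerivAt_pow 2 t).const_add 1) h0) using 1
  field_simp
  ring

lemma norm_deriv_two_mul_sq_div_le (t : ℝ) :
    ‖deriv (fun t : ℝ => 2 * t ^ 2 / (1 + t ^ 2)) t‖ ≤ 4 := by
  rw [(hasDerivAt_two_mul_sq_div t).deriv, Real.norm_eq_abs, abs_div,
    abs_of_pos (show (0 : ℝ) < (1 + t ^ 2) ^ 2 by positivity), div_le_iff₀ (by positivity), abs_mul]
  have h1 : |t| ≤ 1 + t ^ 2 := by
    rw [← sq_abs]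
    nlinarith [sq_nonneg (|t| - 1), abs_nonneg t]
  have h2 : 1 + t ^ 2 ≤ (1 + t ^ 2) ^ 2 := by nlinarith [sq_nonneg t, sq_nonneg (t ^ 2)]
  rw [abs_of_pos (by norm_num : (0 : ℝ) < 4)]
  linarith

lemma exists_bound_cutoff (hη : ContDiff ℝ ∞ η) (hc : HasCompactSupport η) :
    ∃ C : ℝ, 0 < C ∧ (∀ x, ‖η x‖ ≤ C) ∧
      ∀ i x, ‖fderiv ℝ η x (EuclideanSpace.single i 1)‖ ≤ C := by
  obtain ⟨C₀, h0⟩ := hc.exists_bound_of_continuous hη.continuous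
  obtain ⟨C₁, h1⟩ := (hc.fderiv ℝ).exists_bound_of_continuous (hη.continuous_fderiv (by simp))
  have h0' := (norm_nonneg _).trans (h0 0)
  have h1' := (norm_nonneg _).trans (h1 0)
  refine ⟨C₀ + C₁ + 1, by linarith, fun x => by linarith [h0 x], fun i x => ?_⟩
  have := (fderiv ℝ η x).le_opNorm (EuclideanSpace.single i 1)
  rw [PiLp.norm_single, norm_one, mul_one] at this
  linarith [h1 x]

/-- Cutting off an admissible function with small norm gives a nonnegative Sobolev function on the
whole space with small norm. -/
lemma exists_isSmoothLimit_of_relCap_eq_zero (hp : 1 ≤ p) (hΩ : IsOpen Ω)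
    (h0 : relCap p Ω A = 0) (hη : ContDiff ℝ ∞ η) (hc : HasCompactSupport η)
    (hs : tsupport η ⊆ Ω) {δ : ℝ≥0∞} (hδ : 0 < δ) (hδ' : δ ≠ ⊤) :
    ∃ v h G, IsSmoothLimit (ENNReal.ofReal p) v h ∧ (∀ x, 0 ≤ v x) ∧ IsOpen G ∧ A ⊆ G ∧
      (∀ᵐ x, x ∈ G ∩ Ω → η x = 1 → 1 ≤ v x) ∧ eLpNorm v (ENNReal.ofReal p) ≤ δ ∧
      ∀ i, eLpNorm (h i) (ENNReal.ofReal p) ≤ δ := by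
  have hp0 : 0 < p := by linarith
  have hq : 1 ≤ ENNReal.ofReal p := by simpa
  obtain ⟨C, hC0, hηC, hηC'⟩ := exists_bound_cutoff hη hc
  -- The factor 4 bounds the slope of `2t²/(1+t²)`; the two copies of `C` come from the two terms of
  -- the product rule.
  set K := ENNReal.ofReal 4 * (ENNReal.ofReal C + ENNReal.ofReal C) with hK
  have hKtop : K ≠ ⊤ := by finiteness
  have hK0 : K ≠ 0 := by simp [hK, hC0]
  have hδK : 0 < δ / K := ENNReal.div_pos hδ.ne' hKtop
  have hδK' : δ / K ≠ ⊤ := ENNReal.div_ne_top hδ' hK0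
  have hlt : relCap p Ω A < (δ / K) ^ p := by
    rw [h0]
    exact ENNReal.rpow_pos hδK hδK'
  simp only [relCap, iInf_lt_iff] at hlt
  obtain ⟨u, ⟨⟨hW, -⟩, G, hG, hAG, hae⟩, hlt⟩ := hlt
  choose g hg hgL using hW.2
  rw [normPow_eq hΩ hg] at hlt
  have hu0 : eLpNorm u (ENNReal.ofReal p) (volume.restrict Ω) ≤ δ / K :=
    (ENNReal.rpow_le_rpow_iff hp0).1 (le_self_add.trans hlt.le)
  have hg0 i : eLpNorm (g i) (ENNReal.ofReal p) (volume.restrict Ω) ≤ δ / K := by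
    refine (ENNReal.rpow_le_rpow_iff hp0).1 (le_trans ?_ (le_add_self.trans hlt.le))
    exact Finset.single_le_sum
      (f := fun i => eLpNorm (g i) (ENNReal.ofReal p) (volume.restrict Ω) ^ p)
      (fun _ _ => zero_le) (Finset.mem_univ i)
  obtain ⟨m1, n1⟩ := memLp_mul_of_tsupport_subset hΩ hW.1 hη.continuous hηC hs
  have hm2 i := memLp_mul_of_tsupport_subset hΩ (hgL i) hη.continuous hηC hs
  have hm3 i := memLp_mul_of_tsupport_subset hΩ hW.1
    (continuous_fderiv_apply hη (EuclideanSpace.single i 1)) (hηC' i)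
    ((tsupport_fderiv_apply_subset η _).trans hs)
  have hL := (isSmoothLimit_of_isWeakPartial hq ENNReal.ofReal_ne_top m1
    (fun i => (hm2 i).1.add (hm3 i).1) hc.mul_left
    fun i => (hg i).mul_cutoff hη hc hs).comp hq ENNReal.ofReal_ne_top
    (f := fun t => 2 * t ^ 2 / (1 + t ^ 2))
    ((contDiff_const.mul (contDiff_id.pow 2)).div (contDiff_const.add (contDiff_id.pow 2))
      fun t => by positivity) (by simp) norm_deriv_two_mul_sq_div_le
  have hKδ : ENNReal.ofReal 4 * (ENNReal.ofReal C * (δ / K) + ENNReal.ofReal C * (δ / K)) ≤ δ := by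
    rw [← add_mul, ← mul_assoc, ← hK]
    exact ENNReal.mul_div_le
  refine ⟨_, _, G, hL, fun x => by positivity, hG, fun x hx => (hAG hx).1, ?_, ?_, fun i => ?_⟩
  · filter_upwards [(ae_restrict_iff' (hG.inter hΩ).measurableSet).1 hae] with x hx hxG hx1
    have := hx hxG
    -- Where the cutoff is 1, the claim is `1 + u² ≤ 2u²`, which follows from `u ≥ 1`.
    rw [hx1, mul_one, le_div_iff₀ (by positivity)]
    nlinarith
  · refine (eLpNorm_le_mul_eLpNorm_of_ae_le_mul (c := 4) (g := fun x => u x * η x)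
      (ae_of_all _ fun x => ?_) _).trans (le_trans ?_ hKδ)
    · simpa using convex_univ.norm_image_sub_le_of_norm_deriv_le (𝕜 := ℝ)
        (fun x _ => (hasDerivAt_two_mul_sq_div x).differentiableAt)
        (fun x _ => norm_deriv_two_mul_sq_div_le x) (Set.mem_univ 0) (Set.mem_univ (u x * η x))
    · gcongr
      exact n1.trans (le_add_right (by gcongr))
  · refine (eLpNorm_le_mul_eLpNorm_of_ae_le_mul (c := 4)
      (g := (fun x => g i x * η x) + fun x => u x * fderiv ℝ η x (EuclideanSpace.single i 1))
      (ae_of_all _ fun x => ?_) _).trans (le_trans ?_ hKδ)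
    · rw [norm_mul]
      exact mul_le_mul_of_nonneg_right (norm_deriv_two_mul_sq_div_le _) (norm_nonneg _)
    · gcongr
      refine (eLpNorm_add_le (hm2 i).1.1 (hm3 i).1.1 hq).trans (add_le_add ?_ ?_)
      · exact (hm2 i).2.trans (by gcongr; exact hg0 i)
      · exact (hm3 i).2.trans (by gcongr)

/-- A set which is polar relative to an open set containing it is polar relative to the whole
space. -/
lemma relCap_univ_eq_zero (hp : 1 ≤ p) (hΩ : IsOpen Ω) (hne : Ω.Nonempty) (hA : A ⊆ Ω)
    (h0 : relCap p Ω A = 0) : relCap p Set.univ A = 0 := by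
  have hq : 1 ≤ ENNReal.ofReal p := by simpa
  refine le_antisymm (le_of_forall_gt fun ε hε => ?_) zero_le
  obtain ⟨δ, hδ, -, hδε⟩ := exists_pos_mul_rpow_lt (zero_lt_one.trans_le hp) hε N
  -- The norm budget `δ` is split into positive pieces `d n`, one for each cutoff.
  obtain ⟨d, hd, hdδ⟩ := ENNReal.exists_pos_sum_of_countable' hδ.ne' ℕ
  obtain ⟨η, W, hη, hc, hs, hW, hηW, hcov⟩ := exists_cutoff_seq hΩ hne
  choose v h G hL hpos hG hAG hae hv hh using fun n =>
    exists_isSmoothLimit_of_relCap_eq_zero hp hΩ h0 (hη n) (hc n) (hs n) (hd n)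
      ((ENNReal.le_tsum n).trans_lt hdδ).ne_top
  obtain ⟨w, g, hw, hvw, hw0, hg0⟩ := exists_isSmoothLimit_ge hq hL hpos hv hh hdδ.ne_top
  have hadm : Admissible p Set.univ A w := by
    refine ⟨hw.memWTilde hp, ⋃ n, G n ∩ W n, isOpen_iUnion fun n => (hG n).inter (hW n),
      fun x hx => ?_, ?_⟩
    · obtain ⟨n, hn⟩ := Set.mem_iUnion.1 (hcov (hA hx))
      simpa using ⟨n, hAG n hx, hn⟩
    · rw [Set.inter_univ,
        ae_restrict_iff' (isOpen_iUnion fun n => (hG n).inter (hW n)).measurableSet]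
      filter_upwards [hvw, ae_all_iff.2 hae] with x hx hx' hxG
      obtain ⟨n, hxn, hxW⟩ := Set.mem_iUnion.1 hxG
      have h1 := hηW n x hxW
      -- A point where the cutoff equals 1 lies in its support, hence in `Ω`.
      have hxΩ : x ∈ Ω := hs n (subset_tsupport _ (by simp [h1]))
      exact (hx' n ⟨hxn, hxΩ⟩ h1).trans (hx n)
  calc relCap p Set.univ A ≤ normPow p Set.univ w := iInf₂_le w hadm
    _ ≤ (N + 1) * δ ^ p := normPow_univ_le (by linarith) (hw.isWeakPartial hq)
        (hw0.trans hdδ.le) fun i => (hg0 i).trans hdδ.le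
    _ < ε := hδε

/-- Polarity relative to an open set containing `A` is the same as polarity relative to the whole
space. -/
lemma relCap_eq_zero_iff_univ (hp : 1 ≤ p) (hΩ : IsOpen Ω) (hne : Ω.Nonempty) (hA : A ⊆ Ω) :
    relCap p Ω A = 0 ↔ relCap p Set.univ A = 0 :=
  ⟨relCap_univ_eq_zero hp hΩ hne hA, fun h => le_antisymm
    ((relCap_mono (by linarith) hΩ isOpen_univ (Set.subset_univ _) hA).trans_eq h) zero_le⟩

end

end RelCap

end

theorem mainTheorem9 {N : ℕ} {p : ℝ} (hp : 1 < p) :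
    (∀ U V A : Set (EuclideanSpace ℝ (Fin N)), IsOpen U → IsOpen V → U.Nonempty → U ⊆ V → A ⊆ U →
      (RelCap.relCap p U A = 0 ↔ RelCap.relCap p V A = 0)) ∧
    (∀ U V A : Set (EuclideanSpace ℝ (Fin N)), IsOpen U → IsOpen V → U.Nonempty → V.Nonempty →
      A ⊆ U → A ⊆ V → (RelCap.relCap p U A = 0 ↔ RelCap.relCap p V A = 0)) :=
  have key (U V A : Set (EuclideanSpace ℝ (Fin N))) (hU : IsOpen U) (hV : IsOpen V)
      (hUne : U.Nonempty) (hVne : V.Nonempty) (hAU : A ⊆ U) (hAV : A ⊆ V) :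
      RelCap.relCap p U A = 0 ↔ RelCap.relCap p V A = 0 :=
    (RelCap.relCap_eq_zero_iff_univ hp.le hU hUne hAU).trans
      (RelCap.relCap_eq_zero_iff_univ hp.le hV hVne hAV).symm
  ⟨fun U V A hU hV hUne hUV hAU => key U V A hU hV hUne (hUne.mono hUV) hAU (hAU.trans hUV), key⟩
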